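/- Let $F$ be a probability distribution on $\mathbb{R}^2$ with finite second moments, mean vector $(\mu_1,\mu_2)'$ and positive definite covariance matrix $\boldsymbol\Sigma$. For sample sizes $n_1,n_2,n_3$, let the complete pairs $(X_{1j}^{(c)},X_{2j}^{(c)})'$, $j=1,\dots,n_1$, have law $F$, let the incomplete observations $X_{1k}^{(i)}$, $k=1,\dots,n_2$, have the law of the first component under $F$, and $X_{2\ell}^{(i)}$, $\ell=1,\dots,n_3$, the law of the second component under $F$; all these $n_1+n_2+n_3$ random elements are mutually independent. Put $D_j=X_{1j}^{(c)}-X_{2j}^{(c)}$, $\overline D=n_1^{-1}\sum_j D_j$, $\widehat\sigma^2=(n_1-1)^{-1}\sum_j(D_j-\overline D)^2$, let $\overline X_{1}^{(i)},\overline X_{2}^{(i)}$ be the sample means of the two incomplete samples and $\widehat\sigma_1^2,\widehat\sigma_2^2$ their empirical variances with normalization $(n_2-1)^{-1}$ and $(n_3-1)^{-1}$, and set $$T_1=\frac{\overline D}{\sqrt{\widehat\sigma^2/n_1}},\qquad T_2=\frac{\overline X_{1}^{(i)}-\overline X_{2}^{(i)}}{\sqrt{\widehat\sigma_1^2/n_2+\widehat\sigma_2^2/n_3}},\qquad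 T=\sqrt a\,T_1+\sqrt{1-a}\,T_2,$$ where a quotient with denominator $0$ is read as $0$ and the deterministic weight $a\in[0,1]$ may depend on the sample sizes. Suppose that, along a sequence of sample sizes with $\min(n_1,n_2,n_3)\to\infty$, $n_2/(n_2+n_3)\to\kappa\in(0,1)$, while $F$ is fixed. Then under $H_0:\mu_1=\mu_2$, $$\sup_{x\in\mathbb{R}}|P(T\le x)-\Phi(x)|\to 0,$$ where $\Phi$ denotes the distribution function of $N(0,1)$. -/

import Mathlib

open MeasureTheory ProbabilityTheory Filter Topology

noncomputable section

/-- The sample mean of `x₁, …, xₙ`. -/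
def sampleMean {n : ℕ} (x : Fin n → ℝ) : ℝ :=
  (∑ j, x j) / (n : ℝ)

/-- The empirical variance of `x₁, …, xₙ`, normalized by `n - 1` (a difference of real numbers). -/
def sampleVar {n : ℕ} (x : Fin n → ℝ) : ℝ :=
  (∑ j, (x j - sampleMean x) ^ 2) / ((n : ℝ) - 1)

/-- The paired t-statistic of the complete pairs. -/
def pairedT {n₁ : ℕ} (xc : Fin n₁ → ℝ × ℝ) : ℝ :=
  sampleMean (fun j => (xc j).1 - (xc j).2) /
    √(sampleVar (fun j => (xc j).1 - (xc j).2) / (n₁ : ℝ))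

/-- The Welch statistic of the incomplete observations. -/
def welchT {n₂ n₃ : ℕ} (x₁ : Fin n₂ → ℝ) (x₂ : Fin n₃ → ℝ) : ℝ :=
  (sampleMean x₁ - sampleMean x₂) /
    √(sampleVar x₁ / (n₂ : ℝ) + sampleVar x₂ / (n₃ : ℝ))

/-- The weighted statistic with weight `a`. -/
def weightedT (a : ℝ) {n₁ n₂ n₃ : ℕ} (xc : Fin n₁ → ℝ × ℝ)
    (x₁ : Fin n₂ → ℝ) (x₂ : Fin n₃ → ℝ) : ℝ :=
  √a * pairedT xc + √(1 - a) * welchT x₁ x₂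

/-- The covariance matrix of a law `F` on the plane. -/
def covMatrix (F : Measure (ℝ × ℝ)) : Matrix (Fin 2) (Fin 2) ℝ :=
  !![cov[Prod.fst, Prod.fst; F], cov[Prod.fst, Prod.snd; F];
     cov[Prod.snd, Prod.fst; F], cov[Prod.snd, Prod.snd; F]]

/-- Paired data, with law `F` for a pair, some of whose components are missing completely at
random: `Xc` are the complete pairs, `X₁` the first components observed alone, `X₂` the second
components observed alone. All pairs and single observations are mutually independent; this is
expressed by independence within each of the three blocks and independence of the blocks. -/
structure IsIncompletePairedSample {Ω : Type*} [MeasurableSpace Ω] (P : Measure Ω)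
    (F : Measure (ℝ × ℝ)) {n₁ n₂ n₃ : ℕ}
    (Xc : Fin n₁ → Ω → ℝ × ℝ) (X₁ : Fin n₂ → Ω → ℝ) (X₂ : Fin n₃ → Ω → ℝ) : Prop where
  law_complete : ∀ j, HasLaw (Xc j) F P
  law_first : ∀ k, HasLaw (X₁ k) F.fst P
  law_second : ∀ l, HasLaw (X₂ l) F.snd P
  indep_complete : iIndepFun Xc P
  indep_first : iIndepFun X₁ P
  indep_second : iIndepFun X₂ P
  indep_incomplete : IndepFun (fun ω k => X₁ k ω) (fun ω l => X₂ l ω) P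
  indep_blocks : IndepFun (fun ω j => Xc j ω) (fun ω => (fun k => X₁ k ω, fun l => X₂ l ω)) P

end

/-!
Each of the two statistics is a studentized sum, hence asymptotically standard normal, and the two
are independent. For a sum `√a X + √(1 - a) Y` of independent asymptotically standard normal
variables the characteristic function factors. The weight `a` may vary with the sample sizes
without converging, but by compactness of `[0, 1]` every subsequence has a further subsequence along
which it does; there Slutsky's theorem gives the limit `exp (-a t² / 2) exp (-(1 - a) t² / 2)`, which
does not depend on `a`. This is `tendstoInDistribution_sqrt_weighted_add`.

The same lemma handles the Welch statistic: its numerator, divided by the true standard deviation of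
the difference of the two means, is such a weighted sum of the two standardized means, the weight
being the share `welchWeight` of the first sample in the variance. The studentizing factor is
the square root of the convex combination, with the same weight, of the two ratios of empirical to
true variance (`welchT_eq`), so it tends to `1` whatever the weight does. For this reason the limit
`κ` plays no role.

The samples live on a different probability space for each index, but the law of the statistic
depends only on `F` and the sample sizes (`IsIncompletePairedSample.map_weightedT`). So they may be
replaced by initial segments of three infinite i.i.d. sequences on one space, where the strong law
of large numbers gives almost sure convergence of the empirical variances. Finally, Pólya's theorem
(`tendsto_iSup_abs_cdf_sub`) turns convergence in distribution into uniform convergence of the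
distribution functions.
-/

/-! ### Uniform convergence of distribution functions -/

/-- **Pólya's theorem**: if the limit law has no atoms, weak convergence of laws on `ℝ` implies
uniform convergence of the distribution functions. -/
theorem tendsto_iSup_abs_cdf_sub {μs : ℕ → ProbabilityMeasure ℝ} {μ : ProbabilityMeasure ℝ}
    (hμ : NullSingletonClass (μ : Measure ℝ)) (h : Tendsto μs atTop (𝓝 μ)) :
    Tendsto (fun m => ⨆ x : ℝ, |cdf (μs m : Measure ℝ) x - cdf (μ : Measure ℝ) x|) atTop (𝓝 0) := by
  set G : ℝ → ℝ := fun x => cdf (μ : Measure ℝ) x with hG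
  set Gs : ℕ → ℝ → ℝ := fun m x => cdf (μs m : Measure ℝ) x with hGs
  have hmono : Monotone G := monotone_cdf _
  have hmonos : ∀ m, Monotone (Gs m) := fun m => monotone_cdf _
  have hpt : ∀ x, Tendsto (fun m => Gs m x) atTop (𝓝 (G x)) := by
    intro x
    have := ProbabilityMeasure.tendsto_measure_of_null_frontier_of_tendsto' h (E := Set.Iic x) (by simp)
    simpa [hGs, hG, cdf_eq_real, measureReal_def, Function.comp_def] using
      (ENNReal.tendsto_toReal (measure_ne_top (μ : Measure ℝ) _)).comp this
  have hcont : Continuous G := by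
    rw [continuous_iff_continuousAt]
    intro x
    refine (hmono.continuousAt_iff_leftLim_eq_rightLim).2 ?_
    have h1 := (cdf (μ : Measure ℝ)).measure_singleton x
    rw [measure_cdf, measure_singleton] at h1
    have h2 : Function.rightLim G x = G x := (cdf (μ : Measure ℝ)).rightLim_eq x
    rw [h2]
    refine le_antisymm (hmono.leftLim_le le_rfl) ?_
    have := ENNReal.ofReal_eq_zero.1 h1.symm
    exact sub_nonpos.1 this
  -- Uniform closeness on an interval whose endpoints have nearby values under the limit.
  have key : ∀ ε > 0, ∀ u v, G v - G u < ε / 2 →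
      ∀ᶠ m in atTop, ∀ y ∈ Set.Icc u v, |Gs m y - G y| < ε := by
    intro ε hε u v huv
    filter_upwards [Metric.tendsto_nhds.1 (hpt u) (ε / 2) (by positivity),
      Metric.tendsto_nhds.1 (hpt v) (ε / 2) (by positivity)] with m hu hv y hy
    rw [Real.dist_eq, abs_lt] at hu hv
    have := hmono hy.1; have := hmono hy.2
    have := hmonos m hy.1; have := hmonos m hy.2
    rw [abs_lt]; constructor <;> linarith
  have unif : ∀ ε > 0, ∀ᶠ m in atTop, ∀ y, |Gs m y - G y| < ε := by
    intro ε hε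
    obtain ⟨u, hu⟩ := ((tendsto_cdf_atBot (μ : Measure ℝ)).eventually_lt_const
      (show (0 : ℝ) < ε / 2 by positivity)).exists
    obtain ⟨v, hv⟩ := ((tendsto_cdf_atTop (μ : Measure ℝ)).eventually_const_lt
      (show 1 - ε / 2 < (1 : ℝ) by linarith)).exists
    have mid : ∀ᶠ m in atTop, ∀ y ∈ Set.Icc u v, |Gs m y - G y| < ε := by
      refine isCompact_Icc.induction_on (p := fun S => ∀ᶠ m in atTop, ∀ y ∈ S, |Gs m y - G y| < ε)
        (by simp) ?_ ?_ ?_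
      · intro s t hst ht
        filter_upwards [ht] with m hm y hy using hm y (hst hy)
      · intro s t hs ht
        filter_upwards [hs, ht] with m hms hmt y hy using hy.elim (hms y) (hmt y)
      · intro x _
        obtain ⟨δ, hδ, hd⟩ := Metric.continuous_iff.1 hcont x (ε / 4) (by positivity)
        refine ⟨Set.Icc (x - δ / 2) (x + δ / 2),
          mem_nhdsWithin_of_mem_nhds (Icc_mem_nhds (by linarith) (by linarith)), key ε hε _ _ ?_⟩
        have h1 := hd (x - δ / 2) (by rw [Real.dist_eq, abs_lt]; constructor <;> linarith)
        have h2 := hd (x + δ / 2) (by rw [Real.dist_eq, abs_lt]; constructor <;> linarith)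
        rw [Real.dist_eq, abs_lt] at h1 h2
        linarith
    filter_upwards [mid, Metric.tendsto_nhds.1 (hpt u) (ε / 2) (by positivity),
      Metric.tendsto_nhds.1 (hpt v) (ε / 2) (by positivity)] with m hm hum hvm y
    rw [Real.dist_eq, abs_lt] at hum hvm
    have hu' : G u < ε / 2 := hu
    have hv' : 1 - ε / 2 < G v := hv
    have a1 : 0 ≤ G y := cdf_nonneg _ y
    have a2 : G y ≤ 1 := cdf_le_one _ y
    have b1 : 0 ≤ Gs m y := cdf_nonneg _ y
    have b2 : Gs m y ≤ 1 := cdf_le_one _ y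
    rcases le_total u y with h1 | h1
    · rcases le_total y v with h2 | h2
      · exact hm y ⟨h1, h2⟩
      · have := hmono h2; have := hmonos m h2
        rw [abs_lt]; constructor <;> linarith
    · have := hmono h1; have := hmonos m h1
      rw [abs_lt]; constructor <;> linarith
  rw [Metric.tendsto_nhds]
  intro ε hε
  filter_upwards [unif (ε / 2) (by positivity)] with m hm
  have h1 : (⨆ x : ℝ, |Gs m x - G x|) ≤ ε / 2 := ciSup_le fun x => (hm x).le
  have h2 : 0 ≤ ⨆ x : ℝ, |Gs m x - G x| := Real.iSup_nonneg fun x => abs_nonneg _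
  rw [Real.dist_eq, sub_zero, abs_of_nonneg h2]
  linarith

/-! ### Weighted sums of independent asymptotically normal sequences -/

section WeightedSum

variable {Ω : Type*} [MeasurableSpace Ω] {μ : Measure Ω} [IsProbabilityMeasure μ]

/-- A scalar sequence converging to a constant may be multiplied into a sequence converging in
distribution. -/
theorem MeasureTheory.TendstoInDistribution.const_mul_of_tendsto {X : ℕ → Ω → ℝ} {ν : Measure ℝ}
    [IsProbabilityMeasure ν] (hX : TendstoInDistribution X atTop id (fun _ => μ) ν)
    {c : ℕ → ℝ} {c₀ : ℝ} (hc : Tendsto c atTop (𝓝 c₀)) :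
    TendstoInDistribution (fun m ω => c m * X m ω) atTop (fun z => c₀ * z) (fun _ => μ) ν := by
  have h := hX.continuous_comp_prodMk_of_tendstoInMeasure_const
    (g := fun p : ℝ × ℝ => p.2 * p.1) (by fun_prop) (Y := fun m _ => c m) (c := c₀)
    (tendstoInMeasure_of_tendsto_ae (fun _ => by fun_prop) (ae_of_all _ fun _ => hc))
    (fun _ => by fun_prop)
  exact h

theorem MeasureTheory.TendstoInDistribution.comp_tendsto {X : ℕ → Ω → ℝ} {ν : Measure ℝ}
    [IsProbabilityMeasure ν] (hX : TendstoInDistribution X atTop id (fun _ => μ) ν)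
    {n : ℕ → ℕ} (hn : Tendsto n atTop atTop) :
    TendstoInDistribution (fun m => X (n m)) atTop id (fun _ => μ) ν :=
  ⟨fun m => hX.forall_aemeasurable (n m), hX.aemeasurable_limit, hX.tendsto.comp hn⟩

theorem MeasureTheory.TendstoInDistribution.tendsto_charFun {X : ℕ → Ω → ℝ} {Z : ℝ → ℝ} {ν : Measure ℝ}
    [IsProbabilityMeasure ν] (hX : TendstoInDistribution X atTop Z (fun _ => μ) ν) (t : ℝ) :
    Tendsto (fun m => charFun (μ.map (X m)) t) atTop (𝓝 (charFun (ν.map Z) t)) :=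
  ProbabilityMeasure.tendsto_iff_tendsto_charFun.1 hX.tendsto t

theorem charFun_map_const_mul_gaussianReal (c t : ℝ) :
    charFun ((gaussianReal 0 1).map fun z => c * z) t = Complex.exp (-(c ^ 2 * t ^ 2) / 2) := by
  rw [charFun_map_mul, charFun_gaussianReal]
  congr 1
  push_cast
  simp
  ring

/-- If `X m` and `Y m` are independent and both asymptotically standard normal, so is
`√a X m + √(1 - a) Y m`, for weights `a = a m` in `[0, 1]` that need not converge. -/
theorem tendstoInDistribution_sqrt_weighted_add {X Y : ℕ → Ω → ℝ}
    (hX : TendstoInDistribution X atTop id (fun _ => μ) (gaussianReal 0 1))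
    (hY : TendstoInDistribution Y atTop id (fun _ => μ) (gaussianReal 0 1))
    (hXY : ∀ m, IndepFun (X m) (Y m) μ) {a : ℕ → ℝ} (ha : ∀ m, a m ∈ Set.Icc (0 : ℝ) 1) :
    TendstoInDistribution (fun m ω => √(a m) * X m ω + √(1 - a m) * Y m ω) atTop id
      (fun _ => μ) (gaussianReal 0 1) := by
  have mX := hX.forall_aemeasurable
  have mY := hY.forall_aemeasurable
  refine ⟨fun m => by have := mX m; have := mY m; fun_prop, by fun_prop, ?_⟩
  refine ProbabilityMeasure.tendsto_iff_tendsto_charFun.2 fun t => ?_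
  simp only [ProbabilityMeasure.coe_mk, Measure.map_id]
  -- The weights converge along a subsequence, by compactness of `[0, 1]`.
  refine tendsto_of_subseq_tendsto fun ns hns => ?_
  obtain ⟨a₀, ha₀, φ, hφ, hlim⟩ := isCompact_Icc.tendsto_subseq fun k => ha (ns k)
  refine ⟨φ, ?_⟩
  have hsub : Tendsto (fun k => ns (φ k)) atTop atTop := hns.comp hφ.tendsto_atTop
  have h1 := ((hX.comp_tendsto hsub).const_mul_of_tendsto
    (Real.continuous_sqrt.continuousAt.tendsto.comp hlim)).tendsto_charFun t
  have h2 := ((hY.comp_tendsto hsub).const_mul_of_tendsto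
    (Real.continuous_sqrt.continuousAt.tendsto.comp (hlim.const_sub 1))).tendsto_charFun t
  rw [charFun_map_const_mul_gaussianReal] at h1 h2
  have hlimit : charFun (gaussianReal 0 1) t = Complex.exp (-((√a₀ : ℝ) ^ 2 * t ^ 2) / 2) *
      Complex.exp (-((√(1 - a₀) : ℝ) ^ 2 * t ^ 2) / 2) := by
    rw [← Complex.exp_add, charFun_gaussianReal, ← Complex.ofReal_pow √a₀, ← Complex.ofReal_pow √(1 - a₀),
      Real.sq_sqrt ha₀.1, Real.sq_sqrt (sub_nonneg.2 ha₀.2)]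
    congr 1
    push_cast
    ring
  rw [hlimit]
  refine (h1.mul h2).congr fun k => ?_
  have hind : IndepFun (fun ω => √(a (ns (φ k))) * X (ns (φ k)) ω)
      (fun ω => √(1 - a (ns (φ k))) * Y (ns (φ k)) ω) μ :=
    (hXY _).comp (φ := fun x => √(a (ns (φ k))) * x) (ψ := fun y => √(1 - a (ns (φ k))) * y)
      (by fun_prop) (by fun_prop)
  exact (congrFun (hind.charFun_map_fun_add_eq_mul ((mX _).const_mul _) ((mY _).const_mul _))
    t).symm

end WeightedSum

/-! ### Sample mean and sample variance of an i.i.d. sequence -/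

theorem measurable_sampleMean {n : ℕ} : Measurable (sampleMean : (Fin n → ℝ) → ℝ) := by
  unfold sampleMean; fun_prop

theorem measurable_sampleVar {n : ℕ} : Measurable (sampleVar : (Fin n → ℝ) → ℝ) := by
  have := measurable_sampleMean (n := n)
  unfold sampleVar; fun_prop

/-- The empirical variance in terms of the empirical moments, to which the law of large numbers
applies. -/
theorem sampleVar_eq {n : ℕ} (hn : 1 ≤ n) (x : Fin n → ℝ) :
    sampleVar x = ((∑ j, x j ^ 2) / n - ((∑ j, x j) / n) ^ 2) * (n / ((n : ℝ) - 1)) := by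
  have hn' : (n : ℝ) ≠ 0 := by positivity
  have h : ∑ j, (x j - sampleMean x) ^ 2 = ∑ j, x j ^ 2 - (∑ j, x j) ^ 2 / n := by
    simp only [sub_sq, Finset.sum_add_distrib, Finset.sum_sub_distrib, ← Finset.sum_mul,
      ← Finset.mul_sum, Finset.sum_const, Finset.card_univ, Fintype.card_fin, nsmul_eq_mul]
    rw [sampleMean]
    field_simp
    ring
  rw [sampleVar, h]
  field_simp

section IID

variable {Ω : Type*} [MeasurableSpace Ω] {μ : Measure Ω} [IsProbabilityMeasure μ]
  {X : ℕ → Ω → ℝ}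

/-- Strong consistency of the empirical variance. -/
theorem ae_tendsto_sampleVar (hX : MemLp (X 0) 2 μ) (hind : iIndepFun X μ)
    (hid : ∀ i, IdentDistrib (X i) (X 0) μ μ) :
    ∀ᵐ ω ∂μ, Tendsto (fun n : ℕ => sampleVar fun j : Fin n => X j ω) atTop (𝓝 Var[X 0; μ]) := by
  have l1 := strong_law_ae_real X (hX.integrable (by norm_num))
    (fun i j hij => hind.indepFun hij) hid
  have l2 := strong_law_ae_real (fun i ω => X i ω ^ 2) hX.integrable_sq
    (fun i j hij => (hind.indepFun hij).comp (φ := fun x => x ^ 2) (ψ := fun x => x ^ 2)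
      (by fun_prop) (by fun_prop)) (fun i => (hid i).comp (u := fun x => x ^ 2) (by fun_prop))
  have l3 : Tendsto (fun n : ℕ => (n : ℝ) / ((n : ℝ) - 1)) atTop (𝓝 1) := by
    simpa [sub_eq_add_neg] using tendsto_natCast_div_add_atTop (-1 : ℝ)
  filter_upwards [l1, l2] with ω h1 h2
  have hv : Var[X 0; μ] = (μ[fun ω => X 0 ω ^ 2] - μ[X 0] ^ 2) * 1 := by
    rw [variance_eq_sub hX, mul_one]; rfl
  rw [hv]
  refine ((h2.sub (h1.pow 2)).mul l3).congr' ?_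
  filter_upwards [eventually_ge_atTop 1] with n hn
  rw [sampleVar_eq hn, Fin.sum_univ_eq_sum_range (fun j => X j ω ^ 2),
    Fin.sum_univ_eq_sum_range (fun j => X j ω)]

/-- The sample mean of `x₁, …, xₙ`, standardized with mean `c` and variance `v` of a single
observation. It is `0` when `n = 0`, by division by zero. -/
noncomputable def standardizedMean (c v : ℝ) {n : ℕ} (x : Fin n → ℝ) : ℝ :=
  (sampleMean x - c) / √(v / n)

theorem measurable_standardizedMean {c v : ℝ} {n : ℕ} :
    Measurable (standardizedMean c v : (Fin n → ℝ) → ℝ) := by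
  have := measurable_sampleMean (n := n)
  unfold standardizedMean; fun_prop

/-- The central limit theorem for standardized sample means. -/
theorem tendstoInDistribution_standardizedMean (hX : MemLp (X 0) 2 μ) (hind : iIndepFun X μ)
    (hid : ∀ i, IdentDistrib (X i) (X 0) μ μ) (hv : 0 < Var[X 0; μ]) :
    TendstoInDistribution
      (fun (n : ℕ) ω => standardizedMean μ[X 0] Var[X 0; μ] fun j : Fin n => X j ω)
      atTop id (fun _ => μ) (gaussianReal 0 1) := by
  set v := Var[X 0; μ]
  set c := μ[X 0]
  have hY : HasLaw (fun z : ℝ => √v * z) (gaussianReal 0 Var[X 0; μ].toNNReal)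
      (gaussianReal 0 1) := by
    refine ⟨by fun_prop, ?_⟩
    rw [gaussianReal_map_const_mul]
    congr 1
    · simp
    · ext; simp [Real.sq_sqrt hv.le, v, hv.le]
  have h := (tendstoInDistribution_inv_sqrt_mul_sum_sub hY hX hind hid).continuous_comp
    (g := fun x => x / √v) (by fun_prop)
  have hs : √v ≠ 0 := (Real.sqrt_pos.2 hv).ne'
  refine h.congr (fun n => ae_of_all _ fun ω => ?_) (ae_of_all _ fun z => ?_)
  · simp only [Function.comp, standardizedMean, sampleMean,
      Fin.sum_univ_eq_sum_range (fun j => X j ω)]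
    rcases Nat.eq_zero_or_pos n with rfl | hn
    · simp
    · have hn' : (0 : ℝ) < n := by exact_mod_cast hn
      have hsn : √(n : ℝ) ≠ 0 := (Real.sqrt_pos.2 hn').ne'
      rw [Real.sqrt_div hv.le]
      field_simp
      rw [Real.sq_sqrt hn'.le]
  · simp [hs]

/-- Slutsky's theorem for quotients: a denominator that tends to `1` does not affect an asymptotic
normal law. -/
theorem MeasureTheory.TendstoInDistribution.div_of_ae_tendsto_one {T R : ℕ → Ω → ℝ}
    (hT : TendstoInDistribution T atTop id (fun _ => μ) (gaussianReal 0 1))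
    (hR : ∀ᵐ ω ∂μ, Tendsto (fun m => R m ω) atTop (𝓝 1)) (mR : ∀ m, AEMeasurable (R m) μ) :
    TendstoInDistribution (fun m ω => T m ω / R m ω) atTop id (fun _ => μ) (gaussianReal 0 1) := by
  have h := hT.continuous_comp_prodMk_of_tendstoInMeasure_const
    (g := fun p : ℝ × ℝ => p.1 * p.2) (by fun_prop) (Y := fun m ω => (R m ω)⁻¹) (c := 1)
    (tendstoInMeasure_of_tendsto_ae (fun m => (mR m).inv.aestronglyMeasurable) <| by
      filter_upwards [hR] with ω hω
      simpa using hω.inv₀ one_ne_zero)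
    (fun m => (mR m).inv)
  refine h.congr (fun n => ae_of_all _ fun ω => ?_) (ae_of_all _ fun z => ?_)
  · simp [div_eq_mul_inv]
  · simp

end IID

/-! ### The paired and the Welch statistic as studentized sums -/

theorem measurable_pairedT {n₁ : ℕ} : Measurable (pairedT : (Fin n₁ → ℝ × ℝ) → ℝ) := by
  have h₁ := measurable_sampleMean (n := n₁)
  have h₂ := measurable_sampleVar (n := n₁)
  unfold pairedT; fun_prop

theorem Measurable.welchT {α : Type*} [MeasurableSpace α] {n₂ n₃ : ℕ} {x₁ : α → Fin n₂ → ℝ}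
    {x₂ : α → Fin n₃ → ℝ} (h₁ : Measurable x₁) (h₂ : Measurable x₂) :
    Measurable fun ω => welchT (x₁ ω) (x₂ ω) :=
  ((measurable_sampleMean.comp h₁).sub (measurable_sampleMean.comp h₂)).div
    (((measurable_sampleVar.comp h₁).div_const _).add
      ((measurable_sampleVar.comp h₂).div_const _)).sqrt

/-- The paired t-statistic is the standardized mean divided by the square root of the ratio of
empirical to true variance. -/
theorem pairedT_eq {n₁ : ℕ} {v : ℝ} (hv : 0 < v) (xc : Fin n₁ → ℝ × ℝ) :
    pairedT xc = standardizedMean 0 v (fun j => (xc j).1 - (xc j).2) /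
      √(sampleVar (fun j => (xc j).1 - (xc j).2) / v) := by
  rw [pairedT, standardizedMean, sub_zero, div_div, ← Real.sqrt_mul (by positivity)]
  congr 2
  field_simp

/-- The share of the first sample in the variance `v₁ / n₂ + v₂ / n₃` of the difference of the two
sample means. -/
noncomputable def welchWeight (v₁ v₂ : ℝ) (n₂ n₃ : ℕ) : ℝ :=
  (v₁ / n₂) / (v₁ / n₂ + v₂ / n₃)

theorem welchWeight_mem_Icc {v₁ v₂ : ℝ} (h₁ : 0 < v₁) (h₂ : 0 < v₂) (n₂ n₃ : ℕ) :
    welchWeight v₁ v₂ n₂ n₃ ∈ Set.Icc (0 : ℝ) 1 := by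
  have h₁' : 0 ≤ v₁ / n₂ := by positivity
  have h₂' : 0 ≤ v₂ / n₃ := by positivity
  exact ⟨by unfold welchWeight; positivity, div_le_one_of_le₀ (by linarith) (by positivity)⟩

/-- The Welch statistic of two samples is a weighted sum of the standardized means, divided by the
square root of the same convex combination of the ratios of empirical to true variances. The two
samples are centered at a common value `c`, which cancels. -/
theorem welchT_eq {n₂ n₃ : ℕ} (hn₂ : 1 ≤ n₂) (hn₃ : 1 ≤ n₃) {v₁ v₂ : ℝ} (h₁ : 0 < v₁) (h₂ : 0 < v₂)
    (c : ℝ) (x₁ : Fin n₂ → ℝ) (x₂ : Fin n₃ → ℝ) :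
    welchT x₁ x₂ = (√(welchWeight v₁ v₂ n₂ n₃) * standardizedMean c v₁ x₁ +
        √(1 - welchWeight v₁ v₂ n₂ n₃) * -standardizedMean c v₂ x₂) /
      √(welchWeight v₁ v₂ n₂ n₃ * (sampleVar x₁ / v₁) +
        (1 - welchWeight v₁ v₂ n₂ n₃) * (sampleVar x₂ / v₂)) := by
  have hn₂' : (0 : ℝ) < n₂ := by exact_mod_cast hn₂
  have hn₃' : (0 : ℝ) < n₃ := by exact_mod_cast hn₃
  have hp : 0 < v₁ / n₂ := by positivity
  have hq : 0 < v₂ / n₃ := by positivity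
  have hd : 0 < v₁ / n₂ + v₂ / n₃ := by positivity
  have e : 1 - welchWeight v₁ v₂ n₂ n₃ = (v₂ / n₃) / (v₁ / n₂ + v₂ / n₃) := by
    unfold welchWeight; field_simp; ring
  have hden : welchWeight v₁ v₂ n₂ n₃ * (sampleVar x₁ / v₁) +
        (1 - welchWeight v₁ v₂ n₂ n₃) * (sampleVar x₂ / v₂) =
      (v₁ / n₂ + v₂ / n₃)⁻¹ * (sampleVar x₁ / n₂ + sampleVar x₂ / n₃) := by
    rw [e, welchWeight]
    field_simp
  have hnum : √(welchWeight v₁ v₂ n₂ n₃) * standardizedMean c v₁ x₁ +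
        √(1 - welchWeight v₁ v₂ n₂ n₃) * -standardizedMean c v₂ x₂ =
      (sampleMean x₁ - sampleMean x₂) / √(v₁ / n₂ + v₂ / n₃) := by
    have s₁ := (Real.sqrt_pos.2 hp).ne'
    have s₂ := (Real.sqrt_pos.2 hq).ne'
    have s₃ := (Real.sqrt_pos.2 hd).ne'
    rw [e, welchWeight, Real.sqrt_div hp.le, Real.sqrt_div hq.le, standardizedMean,
      standardizedMean]
    generalize √(v₁ / n₂ + v₂ / n₃) = r₃ at *
    generalize √(v₁ / n₂) = r₁ at *
    generalize √(v₂ / n₃) = r₂ at *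
    field_simp
    ring
  rw [hden, hnum, Real.sqrt_mul (by positivity), Real.sqrt_inv, div_div, welchT,
    mul_inv_cancel_left₀ (Real.sqrt_pos.2 hd).ne']

section Limits

variable {Ω : Type*} [MeasurableSpace Ω] {μ : Measure Ω} [IsProbabilityMeasure μ]

theorem MeasureTheory.TendstoInDistribution.neg_gaussianReal {Y : ℕ → Ω → ℝ}
    (hY : TendstoInDistribution Y atTop id (fun _ => μ) (gaussianReal 0 1)) :
    TendstoInDistribution (fun m ω => -Y m ω) atTop id (fun _ => μ) (gaussianReal 0 1) := by
  have h := hY.continuous_comp (continuous_neg (G := ℝ))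
  refine ⟨h.forall_aemeasurable, by fun_prop, ?_⟩
  refine (ProbabilityMeasure.tendsto_iff_tendsto_charFun.2 fun t => ?_)
  have := h.tendsto_charFun t
  have e : (gaussianReal 0 1).map (Neg.neg ∘ id) = gaussianReal 0 1 := by
    simpa using gaussianReal_map_neg (μ := 0) (v := 1)
  rw [e] at this
  simpa [Function.comp_def] using this

/-- The paired t-statistic is asymptotically standard normal. -/
theorem tendstoInDistribution_pairedT {Xc : ℕ → Ω → ℝ × ℝ}
    (hD : MemLp (fun ω => (Xc 0 ω).1 - (Xc 0 ω).2) 2 μ)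
    (hmean : ∫ ω, ((Xc 0 ω).1 - (Xc 0 ω).2) ∂μ = 0)
    (hvar : 0 < Var[fun ω => (Xc 0 ω).1 - (Xc 0 ω).2; μ])
    (mX : ∀ j, Measurable (Xc j)) (hind : iIndepFun Xc μ)
    (hid : ∀ j, IdentDistrib (Xc j) (Xc 0) μ μ) {n : ℕ → ℕ} (hn : Tendsto n atTop atTop) :
    TendstoInDistribution (fun m ω => pairedT fun j : Fin (n m) => Xc j ω) atTop id
      (fun _ => μ) (gaussianReal 0 1) := by
  set D : ℕ → Ω → ℝ := fun j ω => (Xc j ω).1 - (Xc j ω).2 with hDdef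
  have hindD : iIndepFun D μ := hind.comp (fun _ p => p.1 - p.2) (fun _ => by fun_prop)
  have hidD : ∀ j, IdentDistrib (D j) (D 0) μ μ := fun j =>
    (hid j).comp (u := fun p : ℝ × ℝ => p.1 - p.2) (by fun_prop)
  have mD : ∀ j, Measurable (D j) := fun j => by have := mX j; fun_prop
  have hclt := (tendstoInDistribution_standardizedMean hD hindD hidD hvar).comp_tendsto hn
  refine (hclt.div_of_ae_tendsto_one
    (R := fun m ω => √(sampleVar (fun j : Fin (n m) => D j ω) / Var[D 0; μ])) ?_ ?_).congr
    (fun m => ae_of_all _ fun ω => ?_) (ae_of_all _ fun _ => rfl)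
  · filter_upwards [ae_tendsto_sampleVar hD hindD hidD] with ω hω
    have := ((hω.comp hn).div_const Var[D 0; μ]).sqrt
    rwa [div_self hvar.ne', Real.sqrt_one] at this
  · intro m
    have h := measurable_sampleVar (n := n m)
    refine Measurable.aemeasurable ?_
    fun_prop
  · have hm : μ[D 0] = 0 := hmean
    simp only [hm]
    exact (pairedT_eq hvar _).symm

/-- The Welch statistic is asymptotically standard normal as soon as both sample sizes tend to
infinity; their ratio need not converge. -/
theorem tendstoInDistribution_welchT {X₁ X₂ : ℕ → Ω → ℝ}
    (h₁ : MemLp (X₁ 0) 2 μ) (h₂ : MemLp (X₂ 0) 2 μ) (hmean : μ[X₁ 0] = μ[X₂ 0])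
    (hv₁ : 0 < Var[X₁ 0; μ]) (hv₂ : 0 < Var[X₂ 0; μ])
    (m₁ : ∀ k, Measurable (X₁ k)) (m₂ : ∀ l, Measurable (X₂ l))
    (hind₁ : iIndepFun X₁ μ) (hind₂ : iIndepFun X₂ μ)
    (hid₁ : ∀ k, IdentDistrib (X₁ k) (X₁ 0) μ μ) (hid₂ : ∀ l, IdentDistrib (X₂ l) (X₂ 0) μ μ)
    (hind : IndepFun (fun ω k => X₁ k ω) (fun ω l => X₂ l ω) μ)
    {n₂ n₃ : ℕ → ℕ} (hn₂ : Tendsto n₂ atTop atTop) (hn₃ : Tendsto n₃ atTop atTop)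
    (hpos₂ : ∀ m, 1 ≤ n₂ m) (hpos₃ : ∀ m, 1 ≤ n₃ m) :
    TendstoInDistribution
      (fun m ω => welchT (fun k : Fin (n₂ m) => X₁ k ω) (fun l : Fin (n₃ m) => X₂ l ω)) atTop id
      (fun _ => μ) (gaussianReal 0 1) := by
  set v₁ := Var[X₁ 0; μ]
  set v₂ := Var[X₂ 0; μ]
  set c := μ[X₁ 0]
  have hw : ∀ m, welchWeight v₁ v₂ (n₂ m) (n₃ m) ∈ Set.Icc (0 : ℝ) 1 :=
    fun m => welchWeight_mem_Icc hv₁ hv₂ _ _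
  have clt₁ := (tendstoInDistribution_standardizedMean h₁ hind₁ hid₁ hv₁).comp_tendsto hn₂
  have clt₂ := (tendstoInDistribution_standardizedMean h₂ hind₂ hid₂ hv₂).comp_tendsto hn₃
  rw [← hmean] at clt₂
  have hsum := tendstoInDistribution_sqrt_weighted_add clt₁ clt₂.neg_gaussianReal
    (fun m => hind.comp
      (φ := fun s : ℕ → ℝ => standardizedMean c v₁ fun k : Fin (n₂ m) => s k)
      (ψ := fun s : ℕ → ℝ => -standardizedMean c v₂ fun l : Fin (n₃ m) => s l)
      (by have := measurable_standardizedMean (c := c) (v := v₁) (n := n₂ m); fun_prop)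
      (by have := measurable_standardizedMean (c := c) (v := v₂) (n := n₃ m); fun_prop)) hw
  refine (hsum.div_of_ae_tendsto_one (R := fun m ω =>
    √(welchWeight v₁ v₂ (n₂ m) (n₃ m) * (sampleVar (fun k : Fin (n₂ m) => X₁ k ω) / v₁) +
      (1 - welchWeight v₁ v₂ (n₂ m) (n₃ m)) *
        (sampleVar (fun l : Fin (n₃ m) => X₂ l ω) / v₂))) ?_ ?_).congr
    (fun m => ae_of_all _ fun ω => ?_) (ae_of_all _ fun _ => rfl)
  · filter_upwards [ae_tendsto_sampleVar h₁ hind₁ hid₁, ae_tendsto_sampleVar h₂ hind₂ hid₂]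
      with ω e₁ e₂
    have r₁ := ((e₁.comp hn₂).div_const v₁).sub_const 1
    have r₂ := ((e₂.comp hn₃).div_const v₂).sub_const 1
    rw [div_self hv₁.ne', sub_self] at r₁
    rw [div_self hv₂.ne', sub_self] at r₂
    -- Bounded weights times errors that tend to zero.
    have b₁ := r₁.zero_mul_isBoundedUnder_le (g := fun m => welchWeight v₁ v₂ (n₂ m) (n₃ m))
      (isBoundedUnder_of ⟨1, fun m => by
        simpa [abs_of_nonneg (hw m).1] using (hw m).2⟩)
    have b₂ := r₂.zero_mul_isBoundedUnder_le (g := fun m => 1 - welchWeight v₁ v₂ (n₂ m) (n₃ m))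
      (isBoundedUnder_of ⟨1, fun m => by
        simpa [abs_of_nonneg (sub_nonneg.2 (hw m).2)] using (hw m).1⟩)
    have := ((b₁.add b₂).add_const 1).sqrt
    simp only [add_zero, zero_add, Real.sqrt_one] at this
    refine this.congr fun m => ?_
    simp only [Function.comp]
    congr 1
    ring
  · intro m
    have h := measurable_sampleVar (n := n₂ m)
    have h' := measurable_sampleVar (n := n₃ m)
    refine Measurable.aemeasurable ?_
    fun_prop
  · exact (welchT_eq (hpos₂ m) (hpos₃ m) hv₁ hv₂ c _ _).symm

end Limits

/-! ### Moments of the common law -/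

section Moments

variable {F : Measure (ℝ × ℝ)}

theorem variance_fst_pos_of_posDef (hF : (covMatrix F).PosDef) : 0 < Var[Prod.fst; F] := by
  rw [← covariance_self measurable_fst.aemeasurable]
  simpa [covMatrix] using hF.diag_pos (i := 0)

theorem variance_snd_pos_of_posDef (hF : (covMatrix F).PosDef) : 0 < Var[Prod.snd; F] := by
  rw [← covariance_self measurable_snd.aemeasurable]
  simpa [covMatrix] using hF.diag_pos (i := 1)

theorem variance_sub_pos_of_posDef [IsProbabilityMeasure F] (hF : (covMatrix F).PosDef)
    (h₁ : MemLp Prod.fst 2 F) (h₂ : MemLp Prod.snd 2 F) :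
    0 < Var[fun p => p.1 - p.2; F] := by
  have h := hF.dotProduct_mulVec_pos (x := ![1, -1]) (by simp)
  have e := variance_sub h₁ h₂
  have e' : Var[fun p : ℝ × ℝ => p.1 - p.2; F] = Var[Prod.fst - Prod.snd; F] := rfl
  rw [e', e, ← covariance_self measurable_fst.aemeasurable,
    ← covariance_self measurable_snd.aemeasurable]
  simp only [covMatrix, Matrix.mulVec, dotProduct, Fin.sum_univ_two, Pi.star_apply,
    Matrix.of_apply, Matrix.cons_val_zero, Matrix.cons_val_one, star_trivial] at h
  rw [covariance_comm Prod.snd Prod.fst] at h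
  linarith

end Moments

/-! ### Reduction to a fixed sequence of observations -/

section Transfer

theorem measurable_weightedT (a : ℝ) {n₁ n₂ n₃ : ℕ} :
    Measurable fun p : (Fin n₁ → ℝ × ℝ) × (Fin n₂ → ℝ) × (Fin n₃ → ℝ) =>
      weightedT a p.1 p.2.1 p.2.2 := by
  have h₁ : Measurable fun p : (Fin n₁ → ℝ × ℝ) × (Fin n₂ → ℝ) × (Fin n₃ → ℝ) => pairedT p.1 :=
    measurable_pairedT.comp measurable_fst
  have h₂ : Measurable fun p : (Fin n₁ → ℝ × ℝ) × (Fin n₂ → ℝ) × (Fin n₃ → ℝ) =>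
      welchT p.2.1 p.2.2 := measurable_snd.fst.welchT measurable_snd.snd
  exact (h₁.const_mul √a).add (h₂.const_mul √(1 - a))

variable {F : Measure (ℝ × ℝ)} {Ω : Type*} [MeasurableSpace Ω] {P : Measure Ω}
  {n₁ n₂ n₃ : ℕ} {Xc : Fin n₁ → Ω → ℝ × ℝ} {X₁ : Fin n₂ → Ω → ℝ} {X₂ : Fin n₃ → Ω → ℝ}

theorem IsIncompletePairedSample.aemeasurable (h : IsIncompletePairedSample P F Xc X₁ X₂) :
    AEMeasurable (fun ω => (fun j => Xc j ω, fun k => X₁ k ω, fun l => X₂ l ω)) P :=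
  (aemeasurable_pi_lambda _ fun j => (h.law_complete j).aemeasurable).prodMk
    ((aemeasurable_pi_lambda _ fun k => (h.law_first k).aemeasurable).prodMk
      (aemeasurable_pi_lambda _ fun l => (h.law_second l).aemeasurable))

/-- The joint law of an incomplete paired sample is determined by `F` and the sample sizes. -/
theorem IsIncompletePairedSample.map_eq [IsProbabilityMeasure P]
    (h : IsIncompletePairedSample P F Xc X₁ X₂) :
    P.map (fun ω => (fun j => Xc j ω, fun k => X₁ k ω, fun l => X₂ l ω)) =
      (Measure.pi fun _ => F).prod
        ((Measure.pi fun _ => F.fst).prod (Measure.pi fun _ => F.snd)) := by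
  have mc := fun j => (h.law_complete j).aemeasurable
  have m₁ := fun k => (h.law_first k).aemeasurable
  have m₂ := fun l => (h.law_second l).aemeasurable
  have mc' := aemeasurable_pi_lambda (fun ω j => Xc j ω) mc
  have m₁' := aemeasurable_pi_lambda (fun ω k => X₁ k ω) m₁
  have m₂' := aemeasurable_pi_lambda (fun ω l => X₂ l ω) m₂
  rw [(indepFun_iff_map_prod_eq_prod_map_map mc' (m₁'.prodMk m₂')).1 h.indep_blocks,
    (indepFun_iff_map_prod_eq_prod_map_map m₁' m₂').1 h.indep_incomplete,
    (iIndepFun_iff_map_fun_eq_pi_map mc).1 h.indep_complete,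
    (iIndepFun_iff_map_fun_eq_pi_map m₁).1 h.indep_first,
    (iIndepFun_iff_map_fun_eq_pi_map m₂).1 h.indep_second]
  simp only [(h.law_complete _).map_eq, (h.law_first _).map_eq, (h.law_second _).map_eq]

theorem IsIncompletePairedSample.map_weightedT [IsProbabilityMeasure P]
    (h : IsIncompletePairedSample P F Xc X₁ X₂) (a : ℝ) :
    P.map (fun ω => weightedT a (fun j => Xc j ω) (fun k => X₁ k ω) (fun l => X₂ l ω)) =
      ((Measure.pi fun _ => F).prod
        ((Measure.pi fun _ => F.fst).prod (Measure.pi fun _ => F.snd))).map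
        fun p : (Fin n₁ → ℝ × ℝ) × (Fin n₂ → ℝ) × (Fin n₃ → ℝ) =>
          weightedT a p.1 p.2.1 p.2.2 := by
  rw [← h.map_eq, AEMeasurable.map_map_of_aemeasurable
    (measurable_weightedT a).aemeasurable h.aemeasurable]
  rfl

theorem IsIncompletePairedSample.aemeasurable_weightedT
    (h : IsIncompletePairedSample P F Xc X₁ X₂) (a : ℝ) :
    AEMeasurable (fun ω => weightedT a (fun j => Xc j ω) (fun k => X₁ k ω) (fun l => X₂ l ω)) P :=
  Measurable.comp_aemeasurable
    (g := fun p : (Fin n₁ → ℝ × ℝ) × (Fin n₂ → ℝ) × (Fin n₃ → ℝ) => weightedT a p.1 p.2.1 p.2.2)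
    (f := fun ω => (fun j => Xc j ω, fun k => X₁ k ω, fun l => X₂ l ω))
    (measurable_weightedT a) h.aemeasurable

end Transfer

/-- Three infinite i.i.d. sequences, independent of each other, whose initial segments form an
incomplete paired sample with law `F`. -/
structure IsIncompletePairedSequence {Ω : Type*} [MeasurableSpace Ω] (P : Measure Ω)
    (F : Measure (ℝ × ℝ)) (Xc : ℕ → Ω → ℝ × ℝ) (X₁ X₂ : ℕ → Ω → ℝ) : Prop where
  measurable_complete : ∀ j, Measurable (Xc j)
  measurable_first : ∀ k, Measurable (X₁ k)
  measurable_second : ∀ l, Measurable (X₂ l)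
  law_complete : ∀ j, HasLaw (Xc j) F P
  law_first : ∀ k, HasLaw (X₁ k) F.fst P
  law_second : ∀ l, HasLaw (X₂ l) F.snd P
  indep_complete : iIndepFun Xc P
  indep_first : iIndepFun X₁ P
  indep_second : iIndepFun X₂ P
  indep_incomplete : IndepFun (fun ω k => X₁ k ω) (fun ω l => X₂ l ω) P
  indep_blocks : IndepFun (fun ω j => Xc j ω) (fun ω => (fun k => X₁ k ω, fun l => X₂ l ω)) P

/-- The coordinate sequences on a product space. -/
theorem exists_isIncompletePairedSequence (F : Measure (ℝ × ℝ)) [IsProbabilityMeasure F] :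
    ∃ (Ω : Type) (_ : MeasurableSpace Ω) (P : Measure Ω) (_ : IsProbabilityMeasure P)
      (Xc : ℕ → Ω → ℝ × ℝ) (X₁ X₂ : ℕ → Ω → ℝ), IsIncompletePairedSequence P F Xc X₁ X₂ := by
  set Qc : Measure (ℕ → ℝ × ℝ) := Measure.infinitePi fun _ => F
  set Q₁ : Measure (ℕ → ℝ) := Measure.infinitePi fun _ => F.fst
  set Q₂ : Measure (ℕ → ℝ) := Measure.infinitePi fun _ => F.snd
  have pc : MeasurePreserving (fun ω : (ℕ → ℝ × ℝ) × (ℕ → ℝ) × (ℕ → ℝ) => ω.1)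
      (Qc.prod (Q₁.prod Q₂)) Qc := measurePreserving_fst
  have p : MeasurePreserving (fun ω : (ℕ → ℝ × ℝ) × (ℕ → ℝ) × (ℕ → ℝ) => ω.2)
      (Qc.prod (Q₁.prod Q₂)) (Q₁.prod Q₂) := measurePreserving_snd
  have p₁ : MeasurePreserving (fun ω : (ℕ → ℝ × ℝ) × (ℕ → ℝ) × (ℕ → ℝ) => ω.2.1)
      (Qc.prod (Q₁.prod Q₂)) Q₁ := measurePreserving_fst.comp p
  have p₂ : MeasurePreserving (fun ω : (ℕ → ℝ × ℝ) × (ℕ → ℝ) × (ℕ → ℝ) => ω.2.2)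
      (Qc.prod (Q₁.prod Q₂)) Q₂ := measurePreserving_snd.comp p
  have lc : ∀ j, HasLaw (fun ω : (ℕ → ℝ × ℝ) × (ℕ → ℝ) × (ℕ → ℝ) => ω.1 j) F
      (Qc.prod (Q₁.prod Q₂)) :=
    fun j => ((measurePreserving_eval_infinitePi (fun _ => F) j).comp pc).hasLaw
  have l₁ : ∀ k, HasLaw (fun ω : (ℕ → ℝ × ℝ) × (ℕ → ℝ) × (ℕ → ℝ) => ω.2.1 k) F.fst
      (Qc.prod (Q₁.prod Q₂)) :=
    fun k => ((measurePreserving_eval_infinitePi (fun _ => F.fst) k).comp p₁).hasLaw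
  have l₂ : ∀ l, HasLaw (fun ω : (ℕ → ℝ × ℝ) × (ℕ → ℝ) × (ℕ → ℝ) => ω.2.2 l) F.snd
      (Qc.prod (Q₁.prod Q₂)) :=
    fun l => ((measurePreserving_eval_infinitePi (fun _ => F.snd) l).comp p₂).hasLaw
  refine ⟨(ℕ → ℝ × ℝ) × (ℕ → ℝ) × (ℕ → ℝ), inferInstance, Qc.prod (Q₁.prod Q₂), inferInstance,
    fun j ω => ω.1 j, fun k ω => ω.2.1 k, fun l ω => ω.2.2 l, ?_⟩
  refine ⟨fun _ => by fun_prop, fun _ => by fun_prop, fun _ => by fun_prop, lc, l₁, l₂,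
    ?_, ?_, ?_, ?_, ?_⟩
  · exact (iIndepFun_iff_hasLaw_Pi_infinitePi lc (by fun_prop)).2 pc.hasLaw
  · exact (iIndepFun_iff_hasLaw_Pi_infinitePi l₁ (by fun_prop)).2 p₁.hasLaw
  · exact (iIndepFun_iff_hasLaw_Pi_infinitePi l₂ (by fun_prop)).2 p₂.hasLaw
  · refine (indepFun_iff_map_prod_eq_prod_map_map (by fun_prop) (by fun_prop)).2 ?_
    exact p.map_eq.trans (congrArg₂ Measure.prod p₁.map_eq.symm p₂.map_eq.symm)
  · refine (indepFun_iff_map_prod_eq_prod_map_map (by fun_prop) (by fun_prop)).2 ?_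
    exact Measure.map_id.trans (congrArg₂ Measure.prod pc.map_eq.symm p.map_eq.symm)

namespace IsIncompletePairedSequence

variable {F : Measure (ℝ × ℝ)} {Ω : Type*} [MeasurableSpace Ω] {P : Measure Ω}
  {Xc : ℕ → Ω → ℝ × ℝ} {X₁ X₂ : ℕ → Ω → ℝ}

theorem isIncompletePairedSample (h : IsIncompletePairedSequence P F Xc X₁ X₂) (n₁ n₂ n₃ : ℕ) :
    IsIncompletePairedSample P F (fun j : Fin n₁ => Xc j) (fun k : Fin n₂ => X₁ k)
      (fun l : Fin n₃ => X₂ l) where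
  law_complete j := h.law_complete j
  law_first k := h.law_first k
  law_second l := h.law_second l
  indep_complete := h.indep_complete.precomp Fin.val_injective
  indep_first := h.indep_first.precomp Fin.val_injective
  indep_second := h.indep_second.precomp Fin.val_injective
  indep_incomplete := h.indep_incomplete.comp
    (φ := fun (s : ℕ → ℝ) (k : Fin n₂) => s k)
    (ψ := fun (s : ℕ → ℝ) (l : Fin n₃) => s l) (by fun_prop) (by fun_prop)
  indep_blocks := h.indep_blocks.comp (φ := fun (s : ℕ → ℝ × ℝ) (j : Fin n₁) => s j)
    (ψ := fun (s : (ℕ → ℝ) × (ℕ → ℝ)) => (fun k : Fin n₂ => s.1 k, fun l : Fin n₃ => s.2 l)) (by fun_prop) (by fun_prop)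

theorem tendstoInDistribution_weightedT [IsProbabilityMeasure F] [IsProbabilityMeasure P]
    (h : IsIncompletePairedSequence P F Xc X₁ X₂)
    (hF₁ : MemLp Prod.fst 2 F) (hF₂ : MemLp Prod.snd 2 F) (hcov : (covMatrix F).PosDef)
    (hH₀ : ∫ p, p.1 ∂F = ∫ p, p.2 ∂F) {n₁ n₂ n₃ : ℕ → ℕ}
    (hn₁ : Tendsto n₁ atTop atTop) (hn₂ : Tendsto n₂ atTop atTop) (hn₃ : Tendsto n₃ atTop atTop)
    (hpos₂ : ∀ m, 1 ≤ n₂ m) (hpos₃ : ∀ m, 1 ≤ n₃ m)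
    {a : ℕ → ℝ} (ha : ∀ m, a m ∈ Set.Icc (0 : ℝ) 1) :
    TendstoInDistribution
      (fun m ω => weightedT (a m) (fun j : Fin (n₁ m) => Xc j ω) (fun k : Fin (n₂ m) => X₁ k ω)
        (fun l : Fin (n₃ m) => X₂ l ω)) atTop id (fun _ => P) (gaussianReal 0 1) := by
  have lawc := h.law_complete 0
  have law₁ : IdentDistrib (X₁ 0) Prod.fst P F :=
    ⟨(h.law_first 0).aemeasurable, by fun_prop, (h.law_first 0).map_eq⟩
  have law₂ : IdentDistrib (X₂ 0) Prod.snd P F :=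
    ⟨(h.law_second 0).aemeasurable, by fun_prop, (h.law_second 0).map_eq⟩
  have lawD : IdentDistrib (fun ω => (Xc 0 ω).1 - (Xc 0 ω).2) (fun p : ℝ × ℝ => p.1 - p.2) P F :=
    IdentDistrib.comp (u := fun p : ℝ × ℝ => p.1 - p.2) (f := Xc 0) (g := id)
      ⟨lawc.aemeasurable, by fun_prop, by simpa using lawc.map_eq⟩ (by fun_prop)
  have ident : ∀ {α : Type} [MeasurableSpace α] {X : ℕ → Ω → α} {ν : Measure α},
      (∀ i, HasLaw (X i) ν P) → ∀ i, IdentDistrib (X i) (X 0) P P := fun hX i =>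
    ⟨(hX i).aemeasurable, (hX 0).aemeasurable, (hX i).map_eq.trans (hX 0).map_eq.symm⟩
  have hpaired := tendstoInDistribution_pairedT (lawD.memLp_iff.2 (hF₁.sub hF₂))
    (by rw [lawD.integral_eq, integral_sub (hF₁.integrable (by norm_num))
          (hF₂.integrable (by norm_num)), hH₀, sub_self])
    (by rw [lawD.variance_eq]; exact variance_sub_pos_of_posDef hcov hF₁ hF₂)
    h.measurable_complete h.indep_complete (ident h.law_complete) hn₁
  have hwelch := tendstoInDistribution_welchT (law₁.memLp_iff.2 hF₁) (law₂.memLp_iff.2 hF₂)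
    (by rw [law₁.integral_eq, law₂.integral_eq]; exact hH₀)
    (by rw [law₁.variance_eq]; exact variance_fst_pos_of_posDef hcov)
    (by rw [law₂.variance_eq]; exact variance_snd_pos_of_posDef hcov)
    h.measurable_first h.measurable_second h.indep_first h.indep_second
    (ident h.law_first) (ident h.law_second) h.indep_incomplete hn₂ hn₃ hpos₂ hpos₃
  refine tendstoInDistribution_sqrt_weighted_add hpaired hwelch (fun m => ?_) ha
  exact h.indep_blocks.comp (φ := fun s : ℕ → ℝ × ℝ => pairedT fun j : Fin (n₁ m) => s j)
    (ψ := fun s : (ℕ → ℝ) × (ℕ → ℝ) =>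
      welchT (fun k : Fin (n₂ m) => s.1 k) (fun l : Fin (n₃ m) => s.2 l))
    (measurable_pairedT.comp (f := fun (s : ℕ → ℝ × ℝ) (j : Fin (n₁ m)) => s j) (by fun_prop))
    (Measurable.welchT (by fun_prop) (by fun_prop))

end IsIncompletePairedSequence

/-! ### Uniform asymptotic normality of the weighted statistic -/

theorem theorem1
    (F : Measure (ℝ × ℝ)) [IsProbabilityMeasure F]
    (hF₁ : MemLp Prod.fst 2 F) (hF₂ : MemLp Prod.snd 2 F)
    (hcov : (covMatrix F).PosDef)
    (hH₀ : ∫ p, p.1 ∂F = ∫ p, p.2 ∂F)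
    (n₁ n₂ n₃ : ℕ → ℕ)
    (hn : Tendsto (fun m => min (n₁ m) (min (n₂ m) (n₃ m))) atTop atTop)
    (κ : ℝ) (hκ : κ ∈ Set.Ioo (0 : ℝ) 1)
    (hκ_lim : Tendsto (fun m => (n₂ m : ℝ) / ((n₂ m : ℝ) + (n₃ m : ℝ))) atTop (𝓝 κ))
    (a : ℕ → ℝ) (ha : ∀ m, a m ∈ Set.Icc (0 : ℝ) 1)
    (Ω : ℕ → Type*) [∀ m, MeasurableSpace (Ω m)]
    (P : ∀ m, Measure (Ω m)) [∀ m, IsProbabilityMeasure (P m)]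
    (Xc : ∀ m, Fin (n₁ m) → Ω m → ℝ × ℝ)
    (X₁ : ∀ m, Fin (n₂ m) → Ω m → ℝ)
    (X₂ : ∀ m, Fin (n₃ m) → Ω m → ℝ)
    (hX : ∀ m, IsIncompletePairedSample (P m) F (Xc m) (X₁ m) (X₂ m)) :
    Tendsto
      (fun m => ⨆ x : ℝ,
        |(P m).real {ω | weightedT (a m) (fun j => Xc m j ω) (fun k => X₁ m k ω)
            (fun l => X₂ m l ω) ≤ x}
          - cdf (gaussianReal 0 1) x|)
      atTop (𝓝 0) := by
  have hn₁ : Tendsto n₁ atTop atTop := tendsto_atTop_mono (fun m => min_le_left _ _) hn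
  have hn₂ : Tendsto n₂ atTop atTop :=
    tendsto_atTop_mono (fun m => (min_le_right _ _).trans (min_le_left _ _)) hn
  have hn₃ : Tendsto n₃ atTop atTop :=
    tendsto_atTop_mono (fun m => (min_le_right _ _).trans (min_le_right _ _)) hn
  -- Drop the finitely many indices at which the second or the third sample is empty.
  obtain ⟨N, hN⟩ := eventually_atTop.1
    ((hn₂.eventually_ge_atTop 1).and (hn₃.eventually_ge_atTop 1))
  refine (tendsto_add_atTop_iff_nat N).1 ?_
  obtain ⟨Ω', _, Q, _, Yc, Y₁, Y₂, hY⟩ := exists_isIncompletePairedSequence F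
  have hlim := hY.tendstoInDistribution_weightedT hF₁ hF₂ hcov hH₀
    (hn₁.comp (tendsto_add_atTop_nat N)) (hn₂.comp (tendsto_add_atTop_nat N))
    (hn₃.comp (tendsto_add_atTop_nat N)) (fun m => (hN _ (Nat.le_add_left N m)).1)
    (fun m => (hN _ (Nat.le_add_left N m)).2) (a := fun m => a (m + N)) (fun m => ha _)
  have hatom : NullSingletonClass ((gaussianReal 0 1).map id) := by
    rw [Measure.map_id]
    exact nullSingletonClass_gaussianReal one_ne_zero
  refine (tendsto_iSup_abs_cdf_sub (by exact hatom) hlim.tendsto).congr fun m => ?_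
  simp only [ProbabilityMeasure.coe_mk, Measure.map_id]
  refine iSup_congr fun x => ?_
  -- The statistic has the same law on the given space and on the space of sequences.
  have hlaw := ((hY.isIncompletePairedSample (n₁ (m + N)) (n₂ (m + N)) (n₃ (m + N))).map_weightedT
    (a (m + N))).trans ((hX (m + N)).map_weightedT (a (m + N))).symm
  have hmeas := (hX (m + N)).aemeasurable_weightedT (a (m + N))
  have := Measure.isProbabilityMeasure_map hmeas
  simp only [Function.comp]
  rw [hlaw, cdf_eq_real, measureReal_def, Measure.map_apply_of_aemeasurable hmeas measurableSet_Iic]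
  rfl
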